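/- Let $f:\mathbb R^n\to\mathbb R$ be locally Lipschitz continuous, let $F:\mathbb R^n\rightrightarrows\mathbb R^m$ and $G:\mathbb R^n\times\mathbb R^m\rightrightarrows\mathbb R^s$ be set-valued mappings with closed graphs, and let $M\subset\mathbb R^n$ be closed. Consider the program $$\min_z f(z)\quad\text{s.t.}\quad 0\in H(z):=\bigcup_{\lambda\in F(z)}G(z,\lambda),\quad z\in M.$$ Put $K(z):=\{\lambda\in F(z)\mid 0\in G(z,\lambda)\}$, $\widehat K(z,w):=\{\lambda\in F(z)\mid w\in G(z,\lambda)\}$ and $\mathcal H(z,\lambda):=(F(z)-\lambda)\times G(z,\lambda)$. For a set $A$ and $x\in A$ let $\mathcal T_A(x)$ be the Bouligand tangent cone, $\widehat{\mathcal N}_A(x):=\mathcal T_A(x)^\circ$ its polar, and let $\mathcal N_A(x)$ be the limiting normal cone, i.e. the set of all limits of sequences $\xi_k\in\widehat{\mathcal N}_A(x_k)$ with $x_k\in A$, $x_k\to x$. Let $\partial f(x):=\{\xi\mid(\xi,-1)\in\mathcal N_{\operatorname{epi}f}(x,f(x))\}$ be the limiting subdifferential and, for a set-valued mapping $\Upsilon$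 and $(x,y)\in\operatorname{gph}\Upsilon$, let $D^*\Upsilon(x,y)(\eta):=\{\xi\mid(\xi,-\eta)\in\mathcal N_{\operatorname{gph}\Upsilon}(x,y)\}$ be the limiting coderivative. A feasible point $\bar z$ of the program (that is, $\bar z\in M$ and $0\in H(\bar z)$) is called * *implicitly M-stationary* if there is $\nu\in\mathbb R^s$ with $0\in\partial f(\bar z)+D^*H(\bar z,0)(\nu)+\mathcal N_M(\bar z)$; * *fuzzily M-stationary* if there are $\bar\lambda\in K(\bar z)$, $\mu\in\mathbb R^m$, $\nu\in\mathbb R^s$ with $(0,0)\in\partial f(\bar z)\times\{0\}+D^*\mathcal H((\bar z,\bar\lambda),(0,0))(\mu,\nu)+\mathcal N_M(\bar z)\times\{0\}$; * *explicitly M-stationary* if there are $\bar\lambda\in K(\bar z)$, $\mu\in\mathbb R^m$, $\nu\in\mathbb R^s$ with $0\in\partial f(\bar z)+D^*F(\bar z,\bar\lambda)(\mu)+\{\xi\mid(\xi,\mu)\in D^*G((\bar z,\bar\lambda),0)(\nu)\}+\mathcal N_M(\bar z)$. For $\lambda\in K(\bar z)$ let $\mathrm{Inc}(\lambda)$ be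 the condition that, for all $\mu\in\mathbb R^m$ and $\nu\in\mathbb R^s$, $$D^*\mathcal H((\bar z,\lambda),(0,0))(\mu,\nu)\subset D^*F(\bar z,\lambda)(\mu)\times\{-\mu\}+D^*G((\bar z,\lambda),0)(\nu).$$ Let $\bar z$ be implicitly M-stationary, and let $\widehat K$ be inner semicompact at $(\bar z,0)$ w.r.t. $\operatorname{dom}\widehat K$: for each sequence $(z_k,w_k)\to(\bar z,0)$ in $\operatorname{dom}\widehat K$ there are a subsequence $(z_{k_l},w_{k_l})$ and a convergent sequence $\lambda_l\in\widehat K(z_{k_l},w_{k_l})$. Then the following hold. **(a)** If, for each $\lambda\in K(\bar z)$ and all $\mu\in\mathbb R^m$, $$(0,0)\in D^*\mathcal H((\bar z,\lambda),(0,0))(\mu,0)\ \Longrightarrow\ \mu=0,$$ then $\bar z$ is fuzzily M-stationary; if, additionally, $\mathrm{Inc}(\lambda)$ holds for each $\lambda\in K(\bar z)$, then $\bar z$ is explicitly M-stationary. For $\lambda\in K(\bar z)$, the displayed implication holds whenever $\mathcal H$ is metrically regular at $((\bar z,\lambda),(0,0))$. **(b)** If, for each $\lambda\in K(\bar z)$,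 $\mathrm{Inc}(\lambda)$ holds and, for all $\xi\in\mathbb R^n$ and $\mu\in\mathbb R^m$, $$\xi\in D^*F(\bar z,\lambda)(\mu),\ (-\xi,\mu)\in D^*G((\bar z,\lambda),0)(0)\ \Longrightarrow\ \mu=0,$$ then $\bar z$ is explicitly M-stationary. For $\lambda\in K(\bar z)$, the displayed implication holds whenever $G$ has the Aubin property at $((\bar z,\lambda),0)$. **(c)** If, for each $\lambda\in K(\bar z)$ and all $\xi\in\mathbb R^n$ and $\mu\in\mathbb R^m$, $$\xi\in D^*F(\bar z,\lambda)(\mu),\ (-\xi,\mu)\in D^*G((\bar z,\lambda),0)(0)\ \Longrightarrow\ \xi=0\text{ and }\mu=0,$$ then $\bar z$ is explicitly M-stationary. For $\lambda\in K(\bar z)$, the displayed implication holds whenever $G$ has the Aubin property at $((\bar z,\lambda),0)$. -/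

import Mathlib

open Filter Set
open scoped Topology Pointwise

namespace ImplicitVariables

/-- The Euclidean space `ℝⁿ`. -/
abbrev Rn (n : ℕ) : Type := EuclideanSpace ℝ (Fin n)

/-- The product of two Euclidean spaces with its Euclidean structure, i.e. with the inner product
`⟪(x, y), (x', y')⟫ = ⟪x, x'⟫ + ⟪y, y'⟫`. -/
abbrev EProd (E F : Type*) : Type _ := WithLp 2 (E × F)

/-- The element `(x, y)` of the Euclidean product. -/
abbrev epair {E F : Type*} (x : E) (y : F) : EProd E F := WithLp.toLp 2 (x, y)

/-- The Cartesian product of two sets, as a subset of the Euclidean product. -/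
def eprodSet {E F : Type*} (A : Set E) (B : Set F) : Set (EProd E F) :=
  {p | p.fst ∈ A ∧ p.snd ∈ B}

section SetValued

variable {E F : Type*}

/-- The graph of a set-valued mapping. -/
def gph (Υ : E → Set F) : Set (EProd E F) := {p | p.snd ∈ Υ p.fst}

/-- The domain of a set-valued mapping. -/
def dom (Υ : E → Set F) : Set E := {z | (Υ z).Nonempty}

/-- The inverse of a set-valued mapping. -/
def invMap (Υ : E → Set F) : F → Set E := fun w => {z | w ∈ Υ z}

/-- `Υ` is inner semicompact at `z` with respect to `Ω`: for each sequence in `Ω` converging to `z`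
there are a subsequence and a convergent sequence of points in the images along it. -/
def InnerSemicompactAt [TopologicalSpace E] [TopologicalSpace F]
    (Υ : E → Set F) (Ω : Set E) (z : E) : Prop :=
  ∀ zs : ℕ → E, (∀ k, zs k ∈ Ω) → Tendsto zs atTop (𝓝 z) →
    ∃ (φ : ℕ → ℕ) (ws : ℕ → F) (w : F), StrictMono φ ∧ Tendsto ws atTop (𝓝 w) ∧
      ∀ l, ws l ∈ Υ (zs (φ l))

/-- `Υ` has the Aubin property at `(z, w)`. Distances to sets are extended-real valued, so that the
distance to the empty set is `∞`. -/
def AubinAt [PseudoEMetricSpace E] [PseudoEMetricSpace F]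
    (Υ : E → Set F) (z : E) (w : F) : Prop :=
  ∃ κ : ℝ, 0 < κ ∧ ∃ U ∈ 𝓝 z, ∃ V ∈ 𝓝 w, ∀ z₁ ∈ U, ∀ z₂ ∈ U, ∀ w' ∈ Υ z₁ ∩ V,
    Metric.infEDist w' (Υ z₂) ≤ ENNReal.ofReal κ * edist z₁ z₂

/-- `Υ` is metrically regular at `(z, w)`. -/
def MetricallyRegularAt [PseudoEMetricSpace E] [PseudoEMetricSpace F]
    (Υ : E → Set F) (z : E) (w : F) : Prop :=
  ∃ κ : ℝ, 0 < κ ∧ ∃ U ∈ 𝓝 z, ∃ V ∈ 𝓝 w, ∀ z' ∈ U, ∀ w' ∈ V,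
    Metric.infEDist z' (invMap Υ w') ≤ ENNReal.ofReal κ * Metric.infEDist w' (Υ z')

end SetValued

section Normals

variable {E F : Type*} [NormedAddCommGroup E] [InnerProductSpace ℝ E]
  [NormedAddCommGroup F] [InnerProductSpace ℝ F]

/-- The Bouligand tangent cone to `A` at `z`. -/
def tangentCone (A : Set E) (z : E) : Set E :=
  {d | ∃ (zs : ℕ → E) (ts : ℕ → ℝ), (∀ k, zs k ∈ A) ∧ (∀ k, 0 < ts k) ∧
    Tendsto zs atTop (𝓝 z) ∧ Tendsto ts atTop (𝓝 0) ∧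
    Tendsto (fun k => (ts k)⁻¹ • (zs k - z)) atTop (𝓝 d)}

/-- The regular (Fréchet) normal cone: the polar of the tangent cone. -/
def regularNormalCone (A : Set E) (z : E) : Set E :=
  {ξ | ∀ d ∈ tangentCone A z, inner ℝ ξ d ≤ 0}

/-- The limiting (Mordukhovich) normal cone. -/
def limitingNormalCone (A : Set E) (z : E) : Set E :=
  {ξ | ∃ zs ξs : ℕ → E, (∀ k, zs k ∈ A) ∧ Tendsto zs atTop (𝓝 z) ∧
    Tendsto ξs atTop (𝓝 ξ) ∧ ∀ k, ξs k ∈ regularNormalCone A (zs k)}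

/-- The limiting subdifferential of a real-valued function, via the epigraph. -/
def limitingSubdifferential (φ : E → ℝ) (z : E) : Set E :=
  {ξ | epair ξ (-1 : ℝ) ∈
    limitingNormalCone {p : EProd E ℝ | φ p.fst ≤ p.snd} (epair z (φ z))}

/-- The limiting coderivative `D*Υ(z, w) : F ⇉ E` of `Υ : E ⇉ F` at `(z, w)`. -/
def coderivative (Υ : E → Set F) (z : E) (w : F) (η : F) : Set E :=
  {ξ | epair ξ (-η) ∈ limitingNormalCone (gph Υ) (epair z w)}

end Normals

section Problem

variable {n m s : ℕ}

/-- `H(z) = ⋃_{λ ∈ F(z)} G(z, λ)`. -/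
def mapH (F : Rn n → Set (Rn m)) (G : EProd (Rn n) (Rn m) → Set (Rn s)) : Rn n → Set (Rn s) :=
  fun z => ⋃ lam ∈ F z, G (epair z lam)

/-- `K(z) = {λ ∈ F(z) | 0 ∈ G(z, λ)}`. -/
def mapK (F : Rn n → Set (Rn m)) (G : EProd (Rn n) (Rn m) → Set (Rn s)) : Rn n → Set (Rn m) :=
  fun z => {lam | lam ∈ F z ∧ 0 ∈ G (epair z lam)}

/-- `K̂(z, w) = {λ ∈ F(z) | w ∈ G(z, λ)}`. -/
def mapKhat (F : Rn n → Set (Rn m)) (G : EProd (Rn n) (Rn m) → Set (Rn s)) :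
    EProd (Rn n) (Rn s) → Set (Rn m) :=
  fun p => {lam | lam ∈ F p.fst ∧ p.snd ∈ G (epair p.fst lam)}

/-- `𝓗(z, λ) = (F(z) - λ) × G(z, λ)`. -/
def mapCalH (F : Rn n → Set (Rn m)) (G : EProd (Rn n) (Rn m) → Set (Rn s)) :
    EProd (Rn n) (Rn m) → Set (EProd (Rn m) (Rn s)) :=
  fun p => eprodSet ((fun a => a - p.snd) '' F p.fst) (G p)

/-- The feasible set `{z ∈ M | 0 ∈ H(z)}` of the program `min f(z)` s.t. `0 ∈ H(z)`, `z ∈ M`. -/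
def feasibleSet (F : Rn n → Set (Rn m)) (G : EProd (Rn n) (Rn m) → Set (Rn s))
    (M : Set (Rn n)) : Set (Rn n) :=
  {z | 0 ∈ mapH F G z ∧ z ∈ M}

/-- Implicit M-stationarity. -/
def ImplicitlyMStationary (f : Rn n → ℝ) (F : Rn n → Set (Rn m))
    (G : EProd (Rn n) (Rn m) → Set (Rn s)) (M : Set (Rn n)) (z : Rn n) : Prop :=
  z ∈ feasibleSet F G M ∧ ∃ ν : Rn s,
    (0 : Rn n) ∈ limitingSubdifferential f z + coderivative (mapH F G) z 0 ν
      + limitingNormalCone M z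

/-- Fuzzy M-stationarity. -/
def FuzzilyMStationary (f : Rn n → ℝ) (F : Rn n → Set (Rn m))
    (G : EProd (Rn n) (Rn m) → Set (Rn s)) (M : Set (Rn n)) (z : Rn n) : Prop :=
  z ∈ feasibleSet F G M ∧ ∃ lam ∈ mapK F G z, ∃ (μ : Rn m) (ν : Rn s),
    epair (0 : Rn n) (0 : Rn m) ∈
      eprodSet (limitingSubdifferential f z) {(0 : Rn m)}
        + coderivative (mapCalH F G) (epair z lam) (epair 0 0) (epair μ ν)
        + eprodSet (limitingNormalCone M z) {(0 : Rn m)}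

/-- Explicit M-stationarity. -/
def ExplicitlyMStationary (f : Rn n → ℝ) (F : Rn n → Set (Rn m))
    (G : EProd (Rn n) (Rn m) → Set (Rn s)) (M : Set (Rn n)) (z : Rn n) : Prop :=
  z ∈ feasibleSet F G M ∧ ∃ lam ∈ mapK F G z, ∃ (μ : Rn m) (ν : Rn s),
    (0 : Rn n) ∈ limitingSubdifferential f z + coderivative F z lam μ
      + {ξ : Rn n | epair ξ μ ∈ coderivative G (epair z lam) 0 ν}
      + limitingNormalCone M z

/-- The inclusion `Inc(λ)`: for all `μ`, `ν`,
`D*𝓗((z, λ), (0, 0))(μ, ν) ⊆ D*F(z, λ)(μ) × {-μ} + D*G((z, λ), 0)(ν)`. -/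
def Inc (F : Rn n → Set (Rn m)) (G : EProd (Rn n) (Rn m) → Set (Rn s))
    (z : Rn n) (lam : Rn m) : Prop :=
  ∀ (μ : Rn m) (ν : Rn s),
    coderivative (mapCalH F G) (epair z lam) (epair 0 0) (epair μ ν) ⊆
      eprodSet (coderivative F z lam μ) {-μ} + coderivative G (epair z lam) 0 ν

/-- The kernel condition at `λ`: `(0, 0) ∈ D*𝓗((z, λ), (0, 0))(μ, 0)` implies `μ = 0`. -/
def KernelCQ (F : Rn n → Set (Rn m)) (G : EProd (Rn n) (Rn m) → Set (Rn s))
    (z : Rn n) (lam : Rn m) : Prop :=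
  ∀ μ : Rn m,
    epair 0 0 ∈ coderivative (mapCalH F G) (epair z lam) (epair 0 0) (epair μ 0) → μ = 0

/-- The condition at `λ` that `ξ ∈ D*F(z, λ)(μ)` and `(-ξ, μ) ∈ D*G((z, λ), 0)(0)` imply
`μ = 0`. -/
def MuCQ (F : Rn n → Set (Rn m)) (G : EProd (Rn n) (Rn m) → Set (Rn s))
    (z : Rn n) (lam : Rn m) : Prop :=
  ∀ (ξ : Rn n) (μ : Rn m), ξ ∈ coderivative F z lam μ →
    epair (-ξ) μ ∈ coderivative G (epair z lam) 0 0 → μ = 0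

/-- The condition at `λ` that `ξ ∈ D*F(z, λ)(μ)` and `(-ξ, μ) ∈ D*G((z, λ), 0)(0)` imply
`ξ = 0` and `μ = 0`. -/
def StrongCQ (F : Rn n → Set (Rn m)) (G : EProd (Rn n) (Rn m) → Set (Rn s))
    (z : Rn n) (lam : Rn m) : Prop :=
  ∀ (ξ : Rn n) (μ : Rn m), ξ ∈ coderivative F z lam μ →
    epair (-ξ) μ ∈ coderivative G (epair z lam) 0 0 → ξ = 0 ∧ μ = 0

end Problem

end ImplicitVariables

open ImplicitVariables

namespace ImplicitVariables

/-! ### Normal cones and the intersection rule for closed sets. -/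

section NormalCalculus

variable {X Y : Type*} [NormedAddCommGroup X] [InnerProductSpace ℝ X]
  [NormedAddCommGroup Y] [InnerProductSpace ℝ Y]

/-! Let D be the set of points ((z, λ), w) with λ ∈ F(z) and w ∈ G(z, λ). It projects onto the graph
of H, so a regular normal to gph H pulls back to a regular normal to D, with zero λ-component, at
every lift of its base point. Inner semicompactness makes the lifts converge along a subsequence,
and closed graphs put the limit λ in K. Thus implicit stationarity yields a limiting normal ((ξ, 0),
-ν) to D.

It remains to split this normal, by viewing D as an intersection in two ways. Adding a zero slack
turns D into gph 𝓗 ∩ {slack = 0}, and the intersection rule under `KernelCQ` gives fuzzy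
stationarity; `Inc` then makes it explicit. Directly, D is the cylinder over gph F intersected with
gph G, and the rule under `StrongCQ` gives (c). Part (b) reduces to (a), since `Inc` and `MuCQ`
together imply `KernelCQ`.

The intersection rule (`limitingNormalCone_inter_subset`) comes from a quadratic penalization. The
sufficient conditions rest on the Mordukhovich criterion
(`AubinAt.eq_zero_of_mem_coderivative_zero`), applied to G, or to 𝓗⁻¹ for metric regularity. -/

theorem smul_mem_regularNormalCone {A : Set X} {x v : X} {c : ℝ} (hc : 0 ≤ c)
    (hv : v ∈ regularNormalCone A x) : c • v ∈ regularNormalCone A x := by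
  intro d hd
  rw [real_inner_smul_left]
  exact mul_nonpos_of_nonneg_of_nonpos hc (hv d hd)

/-- Proximal normals are regular normals. -/
theorem mem_regularNormalCone_of_quadratic_bound {A : Set X} {x w : X} (c : ℝ)
    (h : ∀ y ∈ A, inner ℝ w (y - x) ≤ c * ‖y - x‖ ^ 2) : w ∈ regularNormalCone A x := by
  rintro d ⟨zs, ts, hA, hpos, hz, -, hd⟩
  have h1 : Tendsto (fun k => inner ℝ w ((ts k)⁻¹ • (zs k - x))) atTop (𝓝 (inner ℝ w d)) :=
    tendsto_const_nhds.inner hd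
  have h2 : Tendsto (fun k => c * (‖(ts k)⁻¹ • (zs k - x)‖ * ‖zs k - x‖)) atTop
      (𝓝 (c * (‖d‖ * ‖x - x‖))) :=
    (hd.norm.mul (hz.sub_const x).norm).const_mul c
  rw [sub_self, norm_zero, mul_zero, mul_zero] at h2
  refine le_of_tendsto_of_tendsto' h1 h2 fun k => ?_
  rw [real_inner_smul_right, norm_smul, Real.norm_of_nonneg (inv_pos.2 (hpos k)).le]
  have := mul_le_mul_of_nonneg_left (h _ (hA k)) (inv_pos.2 (hpos k)).le
  calc _ ≤ _ := this
    _ = _ := by ring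

/-- If `L` maps `D` into `B`, then composing a regular normal to `B` with `L` gives a regular
normal to `D`. -/
theorem regularNormalCone_pullback {D : Set X} {B : Set Y} (L : X →L[ℝ] Y) (hL : MapsTo L D B)
    {x v : X} {ξ : Y} (hv : ∀ d, inner ℝ v d = inner ℝ ξ (L d))
    (hξ : ξ ∈ regularNormalCone B (L x)) : v ∈ regularNormalCone D x := by
  rintro d ⟨zs, ts, hA, hpos, hz, ht, hd⟩
  rw [hv]
  refine hξ _ ⟨fun k => L (zs k), ts, fun k => hL (hA k), hpos,
    (L.continuous.tendsto x).comp hz, ht, ?_⟩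
  simpa [Function.comp_def] using (L.continuous.tendsto d).comp hd

/-- Normals are orthogonal to directions along which the set is translation invariant. -/
theorem inner_eq_zero_of_mem_limitingNormalCone {A : Set X} {x v d : X}
    (hA : ∀ y ∈ A, ∀ t : ℝ, y + t • d ∈ A) (hv : v ∈ limitingNormalCone A x) :
    inner ℝ v d = 0 := by
  have key : ∀ e : X, (∀ y ∈ A, ∀ t : ℝ, y + t • e ∈ A) → inner ℝ v e ≤ 0 := by
    intro e he
    obtain ⟨zs, ξs, hzA, -, hξ, hN⟩ := hv
    refine le_of_tendsto' (hξ.inner tendsto_const_nhds) fun k => hN k e ?_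
    have ht : Tendsto (fun k : ℕ => 1 / ((k : ℝ) + 1)) atTop (𝓝 0) :=
      tendsto_one_div_add_atTop_nhds_zero_nat
    have hp : ∀ j : ℕ, (0 : ℝ) < 1 / ((j : ℝ) + 1) := fun j => Nat.one_div_pos_of_nat
    refine ⟨fun j => zs k + (1 / ((j : ℝ) + 1)) • e, fun j => 1 / ((j : ℝ) + 1),
      fun j => he _ (hzA k) _, hp, ?_, ht, ?_⟩
    · simpa using (ht.smul_const e).const_add (zs k)
    · refine tendsto_const_nhds.congr fun j => ?_
      rw [add_sub_cancel_left, inv_smul_smul₀ (hp j).ne']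
  refine le_antisymm (key d hA) ?_
  have := key (-d) fun y hy t => by simpa using hA y hy (-t)
  rw [inner_neg_right] at this
  linarith

/-- Compactness of balls. Convergence of the points to x follows, being step size times a convergent
quotient. -/
theorem exists_tendsto_mem_tangentCone [FiniteDimensional ℝ X] {A : Set X} {x : X} {zs : ℕ → X}
    {ts : ℕ → ℝ} {R : ℝ} (hA : ∀ k, zs k ∈ A) (hpos : ∀ k, 0 < ts k)
    (ht : Tendsto ts atTop (𝓝 0)) (hR : ∀ k, ‖(ts k)⁻¹ • (zs k - x)‖ ≤ R) :
    ∃ φ : ℕ → ℕ, StrictMono φ ∧ ∃ d ∈ tangentCone A x,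
      Tendsto (fun k => (ts (φ k))⁻¹ • (zs (φ k) - x)) atTop (𝓝 d) := by
  obtain ⟨d, -, φ, hφ, hd⟩ := tendsto_subseq_of_bounded
    (Metric.isBounded_closedBall (x := 0) (r := R))
    (x := fun k => (ts k)⁻¹ • (zs k - x)) (fun k => by simpa using hR k)
  refine ⟨φ, hφ, d, ⟨zs ∘ φ, ts ∘ φ, fun k => hA _, fun k => hpos _, ?_,
    ht.comp hφ.tendsto_atTop, hd⟩, hd⟩
  have h := (ht.comp hφ.tendsto_atTop).smul hd
  rw [zero_smul] at h
  have h' := h.const_add x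
  rw [add_zero] at h'
  refine h'.congr fun k => ?_
  simp [smul_smul, (hpos (φ k)).ne']

/-- Points of `A` at least as close to `x + t • v` as `x` is differ from `x` by `o(t)` if `v` is a
regular normal. -/
theorem exists_forall_norm_lt_of_mem_regularNormalCone [FiniteDimensional ℝ X] {A : Set X}
    {x v : X} (hv : v ∈ regularNormalCone A x) {ε : ℝ} (hε : 0 < ε) :
    ∃ t : ℝ, 0 < t ∧ t ≤ 1 ∧
      ∀ p ∈ A, ‖p - (x + t • v)‖ ≤ ‖x - (x + t • v)‖ → ‖t⁻¹ • (p - x)‖ < ε := by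
  by_contra! hcon
  have hp : ∀ j : ℕ, (0 : ℝ) < 1 / ((j : ℝ) + 1) := fun j => Nat.one_div_pos_of_nat
  have hp1 : ∀ j : ℕ, 1 / ((j : ℝ) + 1) ≤ 1 := fun j => by
    rw [div_le_one (by positivity)]; linarith [(Nat.cast_nonneg j : (0 : ℝ) ≤ j)]
  choose zs hzA hz hze using fun j : ℕ => hcon _ (hp j) (hp1 j)
  have hle : ∀ j : ℕ, ‖(1 / ((j : ℝ) + 1))⁻¹ • (zs j - x) - v‖ ≤ ‖v‖ := by
    intro j
    have h := hz j
    have e : zs j - (x + (1 / ((j : ℝ) + 1)) • v)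
        = (1 / ((j : ℝ) + 1)) • ((1 / ((j : ℝ) + 1))⁻¹ • (zs j - x) - v) := by
      rw [smul_sub, smul_inv_smul₀ (hp j).ne']; abel
    rw [e, sub_add_cancel_left, norm_neg, norm_smul, norm_smul, Real.norm_of_nonneg (hp j).le] at h
    exact le_of_mul_le_mul_left h (hp j)
  obtain ⟨φ, hφ, d, hd, hlim⟩ := exists_tendsto_mem_tangentCone (x := x) (R := ‖v‖ + ‖v‖) hzA hp
    tendsto_one_div_add_atTop_nhds_zero_nat (fun k => by
      have := norm_sub_norm_le ((1 / ((k : ℝ) + 1))⁻¹ • (zs k - x)) v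
      linarith [hle k])
  have h1 : ‖d - v‖ ≤ ‖v‖ := le_of_tendsto' (hlim.sub_const v).norm fun k => hle _
  have h2 : ε ≤ ‖d‖ := ge_of_tendsto' hlim.norm fun k => hze _
  have h3 := hv d hd
  -- Expanding the square gives ‖d‖² ≤ 2⟪v, d⟫ ≤ 0, against ε ≤ ‖d‖.
  have h4 : ‖d - v‖ ^ 2 ≤ ‖v‖ ^ 2 := by gcongr
  rw [norm_sub_sq_real, real_inner_comm] at h4
  nlinarith

/-- A minimizer over a compact piece is global: the pair (x, x) has value R², and since c ≥ 1 any
pair with a smaller value has u₁ within R of q and u₂ within R of u₁. -/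
theorem exists_penalized_minimizer {X : Type*} [NormedAddCommGroup X] [ProperSpace X]
    {C₁ C₂ : Set X} (h₁ : IsClosed C₁) (h₂ : IsClosed C₂) {x : X} (hx₁ : x ∈ C₁) (hx₂ : x ∈ C₂) (q : X) {c : ℝ} (hc : 1 ≤ c) :
    ∃ y₁ ∈ C₁, ∃ y₂ ∈ C₂, ∀ u₁ ∈ C₁, ∀ u₂ ∈ C₂,
      ‖y₁ - q‖ ^ 2 + c * ‖y₁ - y₂‖ ^ 2 ≤ ‖u₁ - q‖ ^ 2 + c * ‖u₁ - u₂‖ ^ 2 := by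
  set R := ‖x - q‖
  set S : Set (X × X) :=
    (C₁ ∩ Metric.closedBall q R) ×ˢ (C₂ ∩ Metric.closedBall q (R + R))
  have hS : IsCompact S :=
    ((isCompact_closedBall q R).inter_left h₁).prod ((isCompact_closedBall q (R + R)).inter_left h₂)
  have hR : 0 ≤ R := norm_nonneg _
  have hxS : (x, x) ∈ S := by
    refine ⟨⟨hx₁, ?_⟩, hx₂, ?_⟩ <;> simp [dist_eq_norm, R]
  obtain ⟨⟨y₁, y₂⟩, hy, hmin⟩ := hS.exists_isMinOn ⟨_, hxS⟩
    (f := fun p : X × X => ‖p.1 - q‖ ^ 2 + c * ‖p.1 - p.2‖ ^ 2) (by fun_prop)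
  refine ⟨y₁, hy.1.1, y₂, hy.2.1, fun u₁ hu₁ u₂ hu₂ => ?_⟩
  by_contra! hlt
  have hx := hmin hxS
  simp only [mem_ofPred_eq, sub_self, norm_zero] at hx
  have hsum : ‖u₁ - q‖ ^ 2 + c * ‖u₁ - u₂‖ ^ 2 < R ^ 2 := by
    have : ‖x - q‖ = R := rfl
    rw [this] at hx
    linarith
  have hb : ‖u₁ - u₂‖ ^ 2 ≤ c * ‖u₁ - u₂‖ ^ 2 := le_mul_of_one_le_left (sq_nonneg _) hc
  have a1 : ‖u₁ - q‖ ≤ R := by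
    refine le_of_abs_le (abs_le_of_sq_le_sq ?_ hR)
    linarith [sq_nonneg ‖u₁ - u₂‖]
  have a2 : ‖u₁ - u₂‖ ≤ R := by
    refine le_of_abs_le (abs_le_of_sq_le_sq ?_ hR)
    linarith [sq_nonneg ‖u₁ - q‖]
  have a3 : ‖u₂ - q‖ ≤ R + R := by
    have : u₂ - q = (u₁ - q) - (u₁ - u₂) := by abel
    rw [this]
    exact (norm_sub_le _ _).trans (add_le_add a1 a2)
  have huS : (u₁, u₂) ∈ S := by
    refine ⟨⟨hu₁, ?_⟩, hu₂, ?_⟩ <;> simpa [dist_eq_norm]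
  exact absurd (hmin huS) (by simpa using hlt)

/-- Fuzzy intersection rule for regular normals. -/
theorem fuzzy_intersection_rule [FiniteDimensional ℝ X] {C₁ C₂ : Set X} (h₁ : IsClosed C₁)
    (h₂ : IsClosed C₂) {x v : X} (hx₁ : x ∈ C₁) (hx₂ : x ∈ C₂)
    (hv : v ∈ regularNormalCone (C₁ ∩ C₂) x) {ε : ℝ} (hε : 0 < ε) :
    ∃ y₁ ∈ C₁, ∃ y₂ ∈ C₂, ∃ a ∈ regularNormalCone C₁ y₁, ∃ b ∈ regularNormalCone C₂ y₂,
      ‖y₁ - x‖ < ε ∧ ‖y₂ - x‖ < ε ∧ ‖a + b - v‖ < ε := by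
  obtain ⟨t, ht, ht1, htp⟩ := exists_forall_norm_lt_of_mem_regularNormalCone hv hε
  set q := x + t • v with hq
  have hc : ∀ k : ℕ, (1 : ℝ) ≤ (k : ℝ) + 1 := fun k => by
    linarith [(Nat.cast_nonneg k : (0 : ℝ) ≤ k)]
  -- As the penalty k + 1 grows, the gap y₁ - y₂ vanishes. A cluster point p then lies in both sets,
  -- no farther from q than x, so the choice of t makes p - x small relative to t.
  choose y₁ hy₁ y₂ hy₂ hmin using
    fun k : ℕ => exists_penalized_minimizer h₁ h₂ hx₁ hx₂ q (hc k)
  have hx : ∀ k, ‖y₁ k - q‖ ^ 2 + ((k : ℝ) + 1) * ‖y₁ k - y₂ k‖ ^ 2 ≤ ‖x - q‖ ^ 2 := fun k => by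
    simpa using hmin k x hx₁ x hx₂
  have hy1 : ∀ k, ‖y₁ k - q‖ ≤ ‖x - q‖ := fun k => by
    refine le_of_abs_le (abs_le_of_sq_le_sq ?_ (norm_nonneg _))
    have := hx k
    have : 0 ≤ ((k : ℝ) + 1) * ‖y₁ k - y₂ k‖ ^ 2 := by positivity
    linarith
  have hsq : Tendsto (fun k => ‖y₁ k - y₂ k‖ ^ 2) atTop (𝓝 0) := by
    have h0 : Tendsto (fun k : ℕ => ‖x - q‖ ^ 2 * (1 / ((k : ℝ) + 1))) atTop (𝓝 0) := by
      simpa using (tendsto_one_div_add_atTop_nhds_zero_nat (𝕜 := ℝ)).const_mul (‖x - q‖ ^ 2)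
    refine squeeze_zero (fun _ => sq_nonneg _) (fun k => ?_) h0
    rw [mul_one_div, le_div_iff₀ (by positivity)]
    nlinarith [hx k, sq_nonneg ‖y₁ k - q‖]
  have hdiff : Tendsto (fun k => y₁ k - y₂ k) atTop (𝓝 0) := by
    rw [tendsto_zero_iff_norm_tendsto_zero]
    have := hsq.sqrt
    simpa using this
  obtain ⟨p, -, φ, hφ, hp⟩ := tendsto_subseq_of_bounded
    (Metric.isBounded_closedBall (x := q) (r := ‖x - q‖)) (x := y₁)
    (fun k => by simpa [dist_eq_norm] using hy1 k)
  have hp2 : Tendsto (fun k => y₂ (φ k)) atTop (𝓝 p) := by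
    have := hp.sub (hdiff.comp hφ.tendsto_atTop)
    simpa using this
  have hpq : ‖p - q‖ ≤ ‖x - q‖ := le_of_tendsto' (hp.sub_const q).norm fun k => hy1 _
  have hpC : p ∈ C₁ ∩ C₂ := ⟨h₁.mem_of_tendsto hp (Eventually.of_forall fun _ => hy₁ _),
    h₂.mem_of_tendsto hp2 (Eventually.of_forall fun _ => hy₂ _)⟩
  have hsmall := htp p hpC hpq
  have hpx : ‖p - x‖ < ε := by
    rw [norm_smul, norm_inv, Real.norm_of_nonneg ht.le, inv_mul_lt_iff₀ ht] at hsmall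
    nlinarith
  have e1 : ∀ᶠ k in atTop, ‖y₁ (φ k) - x‖ < ε := (hp.sub_const x).norm.eventually_lt_const hpx
  have e2 : ∀ᶠ k in atTop, ‖y₂ (φ k) - x‖ < ε := (hp2.sub_const x).norm.eventually_lt_const hpx
  have e3 : ∀ᶠ k in atTop, ‖t⁻¹ • (y₁ (φ k) - x)‖ < ε :=
    ((hp.sub_const x).const_smul t⁻¹).norm.eventually_lt_const hsmall
  obtain ⟨k, k1, k2, k3⟩ := (e1.and (e2.and e3)).exists
  generalize φ k = j at k1 k2 k3
  replace hmin := hmin j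
  set c : ℝ := (j : ℝ) + 1
  set g := y₁ j - y₂ j with hg
  -- These are the first-order conditions of the penalized problem in each variable, divided by t.
  -- The penalty terms cancel in the sum, leaving t⁻¹(q - y₁) = v - t⁻¹(y₁ - x).
  refine ⟨y₁ j, hy₁ j, y₂ j, hy₂ j, t⁻¹ • ((q - y₁ j) - c • g), ?_, t⁻¹ • c • g, ?_, k1, k2, ?_⟩
  · refine smul_mem_regularNormalCone (inv_pos.2 ht).le
      (mem_regularNormalCone_of_quadratic_bound ((1 + c) / 2) fun u hu => ?_)
    have h := hmin u hu _ (hy₂ j)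
    have eq1 : u - q = (u - y₁ j) - (q - y₁ j) := by abel
    have eq2 : u - y₂ j = (u - y₁ j) + g := by simp only [g]; abel
    rw [eq1, eq2, norm_sub_rev (y₁ j) q, norm_sub_sq_real (u - y₁ j), norm_add_sq_real] at h
    rw [inner_sub_left, real_inner_smul_left, real_inner_comm (u - y₁ j) (q - y₁ j),
      real_inner_comm (u - y₁ j) g]
    linarith
  · refine smul_mem_regularNormalCone (inv_pos.2 ht).le
      (mem_regularNormalCone_of_quadratic_bound (c / 2) fun u hu => ?_)
    have h := hmin _ (hy₁ j) u hu
    have eq2 : y₁ j - u = g - (u - y₂ j) := by simp only [g]; abel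
    rw [eq2, norm_sub_sq_real g] at h
    rw [real_inner_smul_left]
    linarith
  · have : t⁻¹ • ((q - y₁ j) - c • g) + t⁻¹ • c • g - v = -(t⁻¹ • (y₁ j - x)) := by
      rw [← smul_add, sub_add_cancel, hq]
      have : v = t⁻¹ • t • v := by rw [inv_smul_smul₀ ht.ne']
      nth_rw 2 [this]
      rw [← smul_sub, ← smul_neg]
      congr 1
      abel
    rw [this, norm_neg]
    exact k3

/-- Intersection rule for limiting normals. -/
theorem limitingNormalCone_inter_subset [FiniteDimensional ℝ X] {C₁ C₂ : Set X}
    (h₁ : IsClosed C₁) (h₂ : IsClosed C₂) {x : X}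
    (hcq : ∀ a ∈ limitingNormalCone C₁ x, -a ∈ limitingNormalCone C₂ x → a = 0) :
    limitingNormalCone (C₁ ∩ C₂) x ⊆ limitingNormalCone C₁ x + limitingNormalCone C₂ x := by
  rintro v ⟨zs, vs, hz, hzx, hvv, hN⟩
  have hp : ∀ j : ℕ, (0 : ℝ) < 1 / ((j : ℝ) + 1) := fun j => Nat.one_div_pos_of_nat
  choose y₁ hy₁ y₂ hy₂ a ha b hb hd₁ hd₂ hab using
    fun k => fuzzy_intersection_rule h₁ h₂ (hz k).1 (hz k).2 (hN k) (hp k)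
  have tend : ∀ {us ws : ℕ → X} {w : X}, Tendsto ws atTop (𝓝 w) →
      (∀ k : ℕ, ‖us k - ws k‖ < 1 / ((k : ℝ) + 1)) → Tendsto us atTop (𝓝 w) := by
    intro us ws w hw h
    have : Tendsto (fun k => us k - ws k) atTop (𝓝 0) :=
      squeeze_zero_norm (fun k => (h k).le) tendsto_one_div_add_atTop_nhds_zero_nat
    simpa using this.add hw
  have ty₁ := tend hzx hd₁
  have ty₂ := tend hzx hd₂
  have tab := tend hvv hab
  by_cases hbd : ∃ R, ∃ᶠ k in atTop, a k ∈ Metric.closedBall (0 : X) R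
  · obtain ⟨R, hR⟩ := hbd
    obtain ⟨a', -, φ, hφ, hlim⟩ :=
      tendsto_subseq_of_frequently_bounded Metric.isBounded_closedBall hR
    have tφ := hφ.tendsto_atTop
    refine ⟨a', ⟨y₁ ∘ φ, a ∘ φ, fun k => hy₁ _, ty₁.comp tφ, hlim, fun k => ha _⟩, v - a',
      ⟨y₂ ∘ φ, b ∘ φ, fun k => hy₂ _, ty₂.comp tφ, ?_, fun k => hb _⟩, add_sub_cancel _ _⟩
    simpa [Function.comp_def] using (tab.comp tφ).sub hlim
  -- If ‖a k‖ → ∞, normalize: since a k + b k converges, the scaled sequences have limits e and -e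
  -- with ‖e‖ = 1, which the qualification condition excludes.
  · exfalso
    have hinf : Tendsto (fun k => ‖a k‖) atTop atTop := by
      rw [tendsto_atTop]
      intro R
      have : ¬∃ᶠ k in atTop, a k ∈ Metric.closedBall 0 R := fun h => hbd ⟨R, h⟩
      rw [not_frequently] at this
      filter_upwards [this] with k hk
      simp only [Metric.mem_closedBall, dist_zero_right, not_le] at hk
      exact hk.le
    have hs : ∀ k, ‖‖a k‖⁻¹ • a k‖ ≤ 1 := fun k => by
      rw [norm_smul, norm_inv, norm_norm]
      exact inv_mul_le_one
    obtain ⟨e, -, φ, hφ, hlim⟩ := tendsto_subseq_of_bounded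
      (Metric.isBounded_closedBall (x := (0 : X)) (r := 1)) (x := fun k => ‖a k‖⁻¹ • a k)
      (fun k => by simpa using hs k)
    have tφ := hφ.tendsto_atTop
    have hinv : Tendsto (fun k => ‖a (φ k)‖⁻¹) atTop (𝓝 0) :=
      (tendsto_inv_atTop_zero.comp hinf).comp tφ
    have hlim2 : Tendsto (fun k => ‖a (φ k)‖⁻¹ • b (φ k)) atTop (𝓝 (-e)) := by
      have := (hinv.smul (tab.comp tφ)).sub hlim
      simpa [Function.comp_def, smul_add] using this
    have he : e = 0 := hcq e
      ⟨y₁ ∘ φ, _, fun k => hy₁ _, ty₁.comp tφ, hlim,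
        fun k => smul_mem_regularNormalCone (by positivity) (ha _)⟩
      ⟨y₂ ∘ φ, _, fun k => hy₂ _, ty₂.comp tφ, hlim2,
        fun k => smul_mem_regularNormalCone (by positivity) (hb _)⟩
    have hone : Tendsto (fun k => ‖‖a (φ k)‖⁻¹ • a (φ k)‖) atTop (𝓝 1) := by
      refine tendsto_const_nhds.congr' ?_
      filter_upwards [(hinf.comp tφ).eventually_gt_atTop 0] with k hk
      simp only [Function.comp_apply] at hk
      rw [norm_smul, norm_inv, norm_norm, inv_mul_cancel₀ hk.ne']
    have := tendsto_nhds_unique hone hlim.norm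
    simp [he] at this

end NormalCalculus

/-! ### Graphs in Euclidean products, coderivatives and the Mordukhovich criterion. -/

section Graphs

variable {X Y Z : Type*} [NormedAddCommGroup X] [InnerProductSpace ℝ X]
  [NormedAddCommGroup Y] [InnerProductSpace ℝ Y] [NormedAddCommGroup Z] [InnerProductSpace ℝ Z]

theorem inner_eprod (p q : EProd X Y) :
    inner ℝ p q = inner ℝ p.fst q.fst + inner ℝ p.snd q.snd := rfl

theorem eprod_ext {X Y : Type*} {p q : EProd X Y} (h₁ : p.fst = q.fst) (h₂ : p.snd = q.snd) :
    p = q :=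
  WithLp.ofLp_injective 2 (Prod.ext h₁ h₂)

theorem norm_epair_zero_left {X Y : Type*} [NormedAddCommGroup X] [NormedAddCommGroup Y] (y : Y) :
    ‖(epair 0 y : EProd X Y)‖ = ‖y‖ := by
  rw [← sq_eq_sq₀ (norm_nonneg _) (norm_nonneg _), WithLp.prod_norm_sq_eq_of_L2]
  simp

theorem tendsto_epair {X Y ι : Type*} [TopologicalSpace X] [TopologicalSpace Y]
    {l : Filter ι} {u : ι → X} {v : ι → Y} {x : X} {y : Y}
    (hu : Tendsto u l (𝓝 x)) (hv : Tendsto v l (𝓝 y)) :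
    Tendsto (fun i => epair (u i) (v i)) l (𝓝 (epair x y)) :=
  ((WithLp.prod_continuous_toLp 2 X Y).tendsto (x, y)).comp (hu.prodMk_nhds hv)

theorem tendsto_fst {ι : Type*} {l : Filter ι} {u : ι → EProd X Y} {p : EProd X Y}
    (hu : Tendsto u l (𝓝 p)) : Tendsto (fun i => (u i).fst) l (𝓝 p.fst) :=
  ((WithLp.fstL 2 ℝ X Y).continuous.tendsto p).comp hu

theorem tendsto_snd {ι : Type*} {l : Filter ι} {u : ι → EProd X Y} {p : EProd X Y}
    (hu : Tendsto u l (𝓝 p)) : Tendsto (fun i => (u i).snd) l (𝓝 p.snd) :=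
  ((WithLp.sndL 2 ℝ X Y).continuous.tendsto p).comp hu

/-- The continuous linear map `x ↦ (f x, g x)` into the Euclidean product. -/
noncomputable def epairL (f : X →L[ℝ] Y) (g : X →L[ℝ] Z) : X →L[ℝ] EProd Y Z :=
  ((WithLp.prodContinuousLinearEquiv 2 ℝ Y Z).symm : (Y × Z) →L[ℝ] EProd Y Z).comp (f.prod g)

theorem epairL_apply (f : X →L[ℝ] Y) (g : X →L[ℝ] Z) (x : X) :
    epairL f g x = epair (f x) (g x) := rfl

theorem mem_coderivative {Υ : X → Set Y} {z ξ : X} {w η : Y} :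
    ξ ∈ coderivative Υ z w η ↔ epair ξ (-η) ∈ limitingNormalCone (gph Υ) (epair z w) :=
  Iff.rfl

/-- Limiting normals pull back along linear maps which have a continuous section. -/
theorem limitingNormalCone_pullback {D : Set X} {B : Set Y} (L : X →L[ℝ] Y) (hL : MapsTo L D B)
    (L' : Y →L[ℝ] X) (hL' : ∀ ξ d, inner ℝ (L' ξ) d = inner ℝ ξ (L d))
    {S : Y → X} (hSc : Continuous S) (hS : MapsTo S B D) (hLS : ∀ y, L (S y) = y)
    {y ξ : Y} (hξ : ξ ∈ limitingNormalCone B y) : L' ξ ∈ limitingNormalCone D (S y) := by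
  obtain ⟨zs, ξs, hz, hzy, hξs, hN⟩ := hξ
  refine ⟨fun k => S (zs k), fun k => L' (ξs k), fun k => hS (hz k), (hSc.tendsto y).comp hzy,
    (L'.continuous.tendsto ξ).comp hξs, fun k =>
      regularNormalCone_pullback L hL (hL' _) ?_⟩
  rw [hLS]
  exact hN k

/-- Normals to the cylinder over a set. -/
theorem mem_limitingNormalCone_cylinder {A : Set X} {x : X} {y : Y} {q : EProd X Y}
    (hq : q ∈ limitingNormalCone {p : EProd X Y | p.fst ∈ A} (epair x y)) :
    q.fst ∈ limitingNormalCone A x ∧ q.snd = 0 := by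
  constructor
  · obtain ⟨zs, qs, hz, hzx, hqs, hN⟩ := hq
    refine ⟨fun k => (zs k).fst, fun k => (qs k).fst, hz, tendsto_fst hzx, tendsto_fst hqs, ?_⟩
    rintro k d ⟨us, ts, hu, hpos, hux, ht, hd⟩
    have h := hN k (epair d 0) ⟨fun j => epair (us j) (zs k).snd, ts, hu, hpos,
      tendsto_epair hux tendsto_const_nhds, ht, ?_⟩
    · simpa [inner_eprod] using h
    · refine (tendsto_epair hd tendsto_const_nhds).congr fun j => ?_
      refine eprod_ext rfl ?_
      simp
  · have h := inner_eq_zero_of_mem_limitingNormalCone (d := epair 0 q.snd)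
      (fun p hp t => by simpa using hp) hq
    simpa [inner_eprod] using h

/-- Tests a normal against a direction u feasible only up to bounded corrections e in V; a limit of
corrections makes u + e tangent. -/
theorem exists_inner_nonpos_of_mem_regularNormalCone [FiniteDimensional ℝ X] {A V : Set X}
    (hV : IsClosed V) {x u ξ : X} {R : ℝ} (hξ : ξ ∈ regularNormalCone A x)
    (h : ∀ᶠ t : ℝ in 𝓝[>] 0, ∃ e ∈ V, ‖e‖ ≤ R ∧ x + t • (u + e) ∈ A) :
    ∃ e ∈ V, ‖e‖ ≤ R ∧ inner ℝ ξ (u + e) ≤ 0 := by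
  obtain ⟨δ, hδ, hsub⟩ := mem_nhdsGT_iff_exists_Ioo_subset.1 h
  simp only [mem_Ioi] at hδ
  have hp : ∀ j : ℕ, 0 < δ / 2 * (1 / ((j : ℝ) + 1)) := fun j => by positivity
  have hlt : ∀ j : ℕ, δ / 2 * (1 / ((j : ℝ) + 1)) < δ := fun j => by
    have : 1 / ((j : ℝ) + 1) ≤ 1 := by
      rw [div_le_one (by positivity)]; linarith [(Nat.cast_nonneg j : (0 : ℝ) ≤ j)]
    nlinarith
  have ht : Tendsto (fun j : ℕ => δ / 2 * (1 / ((j : ℝ) + 1))) atTop (𝓝 0) := by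
    simpa using (tendsto_one_div_add_atTop_nhds_zero_nat (𝕜 := ℝ)).const_mul (δ / 2)
  choose e heV heR heA using fun j => hsub ⟨hp j, hlt j⟩
  have heq : ∀ j : ℕ, (δ / 2 * (1 / ((j : ℝ) + 1)))⁻¹ •
      (x + (δ / 2 * (1 / ((j : ℝ) + 1))) • (u + e j) - x) = u + e j := fun j => by
    rw [add_sub_cancel_left, inv_smul_smul₀ (hp j).ne']
  obtain ⟨φ, hφ, d, hd, hlim⟩ := exists_tendsto_mem_tangentCone (R := ‖u‖ + R) heA hp ht
    (fun k => by
      rw [heq]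
      exact (norm_add_le _ _).trans (by linarith [heR k]))
  simp only [heq] at hlim
  have hlim' : Tendsto (fun k => e (φ k)) atTop (𝓝 (d - u)) := by
    simpa using hlim.sub_const u
  refine ⟨d - u, hV.mem_of_tendsto hlim' (Eventually.of_forall fun _ => heV _),
    le_of_tendsto' hlim'.norm fun _ => heR _, ?_⟩
  rw [add_sub_cancel]
  exact hξ d hd

/-- The Mordukhovich criterion, necessity: the Aubin property forces `D*Υ(z, w)(0) = {0}`. -/
theorem AubinAt.eq_zero_of_mem_coderivative_zero [FiniteDimensional ℝ X] [FiniteDimensional ℝ Y]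
    {Υ : X → Set Y} {z : X} {w : Y} (h : AubinAt Υ z w) {ξ : X}
    (hξ : ξ ∈ coderivative Υ z w 0) : ξ = 0 := by
  obtain ⟨κ, hκ, U, hU, V, hV, hA⟩ := h
  obtain ⟨zs, ξs, hz, hzz, hξs, hN⟩ := hξ
  -- Move the base point along the first component ξ₁ of the normal. The Aubin property supplies a
  -- correction e in the values of size at most (κ + 1)‖ξ₁‖, so ‖ξ₁‖² ≤ -⟪ξ₂, e⟫ gives the bound.
  -- The extra 1 makes the distance estimate strict, so that a nearby point exists.
  have key : ∀ᶠ k in atTop, ‖(ξs k).fst‖ ≤ (κ + 1) * ‖(ξs k).snd‖ := by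
    filter_upwards [(tendsto_fst hzz).eventually (eventually_mem_nhds_iff.2 hU),
      (tendsto_snd hzz).eventually_mem hV] with k hkU hkV
    by_cases h0 : (ξs k).fst = 0
    · rw [h0, norm_zero]; positivity
    have hpos : 0 < ‖(ξs k).fst‖ := norm_pos_iff.2 h0
    obtain ⟨e, he0, heR, hin⟩ := exists_inner_nonpos_of_mem_regularNormalCone
      (V := {p : EProd X Y | p.fst = 0}) (u := epair (ξs k).fst 0)
      (R := (κ + 1) * ‖(ξs k).fst‖)
      (isClosed_eq (WithLp.fstL 2 ℝ X Y).continuous continuous_const) (hN k) (by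
        have hcont : Tendsto (fun t : ℝ => (zs k).fst + t • (ξs k).fst) (𝓝[>] 0)
            (𝓝 (zs k).fst) := by
          have : Continuous fun t : ℝ => (zs k).fst + t • (ξs k).fst := by fun_prop
          simpa using (this.tendsto 0).mono_left nhdsWithin_le_nhds
        filter_upwards [hcont.eventually_mem hkU, self_mem_nhdsWithin] with t htU ht
        have ht : 0 < t := ht
        have hdist := hA _ (mem_of_mem_nhds hkU) _ htU (zs k).snd ⟨hz k, hkV⟩
        have hlt : Metric.infEDist (zs k).snd (Υ ((zs k).fst + t • (ξs k).fst)) <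
            ENNReal.ofReal (t * ((κ + 1) * ‖(ξs k).fst‖)) := by
          refine hdist.trans_lt ?_
          rw [edist_dist, ← ENNReal.ofReal_mul hκ.le, ENNReal.ofReal_lt_ofReal_iff (by positivity),
            dist_self_add_right, norm_smul, Real.norm_of_nonneg ht.le]
          nlinarith [mul_pos ht hpos]
        obtain ⟨y, hy, hyd⟩ := Metric.infEDist_lt_iff.1 hlt
        rw [edist_dist, ENNReal.ofReal_lt_ofReal_iff (by positivity), dist_eq_norm] at hyd
        refine ⟨epair 0 (t⁻¹ • (y - (zs k).snd)), rfl, ?_, ?_⟩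
        · rw [norm_epair_zero_left, norm_smul, norm_inv, Real.norm_of_nonneg ht.le,
            inv_mul_le_iff₀ ht, norm_sub_rev]
          exact hyd.le
        · have : zs k + t • (epair (ξs k).fst 0 + epair 0 (t⁻¹ • (y - (zs k).snd)))
              = epair ((zs k).fst + t • (ξs k).fst) y := by
            refine eprod_ext ?_ ?_
            · simp
            · simp [ht.ne']
          rw [this]
          exact hy)
    have he0 : e.fst = 0 := he0
    have hen : ‖e.snd‖ = ‖e‖ := by
      rw [← sq_eq_sq₀ (norm_nonneg _) (norm_nonneg _), WithLp.prod_norm_sq_eq_of_L2 e, he0]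
      simp
    have hsum : epair (ξs k).fst 0 + e = epair (ξs k).fst e.snd :=
      eprod_ext (by simp [he0]) (by simp)
    rw [hsum, inner_eprod] at hin
    change inner ℝ (ξs k).fst (ξs k).fst + inner ℝ (ξs k).snd e.snd ≤ 0 at hin
    rw [real_inner_self_eq_norm_sq] at hin
    have hcs := neg_le_of_abs_le (abs_real_inner_le_norm (ξs k).snd e.snd)
    have : ‖(ξs k).snd‖ * ‖e.snd‖ ≤ ‖(ξs k).snd‖ * ((κ + 1) * ‖(ξs k).fst‖) := by
      rw [hen]; gcongr
    have h3 : ‖(ξs k).fst‖ * ‖(ξs k).fst‖ ≤ ((κ + 1) * ‖(ξs k).snd‖) * ‖(ξs k).fst‖ := by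
      nlinarith
    exact le_of_mul_le_mul_right h3 hpos
  have hlim := le_of_tendsto_of_tendsto (tendsto_fst hξs).norm
    ((tendsto_snd hξs).norm.const_mul (κ + 1)) key
  simpa using hlim

/-- For w₁ ∈ Υ(z'), the distance from w₂ to Υ(z') is at most that from w₂ to w₁. -/
theorem MetricallyRegularAt.aubinAt_invMap {X Y : Type*} [PseudoEMetricSpace X]
    [PseudoEMetricSpace Y] {Υ : X → Set Y} {z : X} {w : Y} (h : MetricallyRegularAt Υ z w) :
    AubinAt (invMap Υ) w z := by
  obtain ⟨κ, hκ, U, hU, V, hV, h⟩ := h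
  refine ⟨κ, hκ, V, hV, U, hU, fun w₁ _ w₂ hw₂ z' hz' => (h z' hz'.2 w₂ hw₂).trans ?_⟩
  rw [edist_comm]
  gcongr
  exact Metric.infEDist_le_edist_of_mem hz'.1

/-- Swapping the two factors is an isometry exchanging the graphs. -/
theorem neg_mem_coderivative_invMap {Υ : X → Set Y} {z ξ : X} {w η : Y}
    (h : ξ ∈ coderivative Υ z w η) : -η ∈ coderivative (invMap Υ) w z (-ξ) := by
  have := limitingNormalCone_pullback (D := gph (invMap Υ))
    (epairL (WithLp.sndL 2 ℝ Y X) (WithLp.fstL 2 ℝ Y X)) (fun p hp => hp)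
    (epairL (WithLp.sndL 2 ℝ X Y) (WithLp.fstL 2 ℝ X Y))
    (fun ξ d => by simp [epairL_apply, add_comm])
    (epairL (WithLp.sndL 2 ℝ X Y) (WithLp.fstL 2 ℝ X Y)).continuous (fun p hp => hp)
    (fun _ => rfl) h
  simpa [mem_coderivative, epairL_apply] using this

/-- Metric regularity forces the kernel of the coderivative to be trivial. -/
theorem MetricallyRegularAt.eq_zero_of_zero_mem_coderivative [FiniteDimensional ℝ X]
    [FiniteDimensional ℝ Y] {Υ : X → Set Y} {z : X} {w η : Y} (h : MetricallyRegularAt Υ z w)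
    (hη : 0 ∈ coderivative Υ z w η) : η = 0 := by
  have h' := neg_mem_coderivative_invMap hη
  rw [neg_zero] at h'
  exact neg_eq_zero.1 (h.aubinAt_invMap.eq_zero_of_mem_coderivative_zero h')

end Graphs

/-! ### The joint graph and the three stationarity notions. -/

section Stationarity

variable {n m s : ℕ} {F : Rn n → Set (Rn m)} {G : EProd (Rn n) (Rn m) → Set (Rn s)}
  {f : Rn n → ℝ} {M : Set (Rn n)} {z : Rn n} {lam : Rn m}

/-- The points `((z, λ), w)` with `λ ∈ F(z)` and `w ∈ G(z, λ)`. -/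
def jointGraph (F : Rn n → Set (Rn m)) (G : EProd (Rn n) (Rn m) → Set (Rn s)) :
    Set (EProd (EProd (Rn n) (Rn m)) (Rn s)) :=
  {p | p.fst ∈ gph F} ∩ gph G

theorem isClosed_cylinder {X Y : Type*} [TopologicalSpace X] [TopologicalSpace Y] {A : Set X}
    (hA : IsClosed A) : IsClosed {p : EProd X Y | p.fst ∈ A} :=
  hA.preimage (WithLp.continuous_fst 2 X Y)

theorem isClosed_gph_mapCalH (hF : IsClosed (gph F)) (hG : IsClosed (gph G)) :
    IsClosed (gph (mapCalH F G)) := by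
  have h₁ : Continuous fun p : EProd (EProd (Rn n) (Rn m)) (EProd (Rn m) (Rn s)) =>
      epair p.fst.fst (p.fst.snd + p.snd.fst) := by
    refine (WithLp.prod_continuous_toLp 2 _ _).comp (Continuous.prodMk ?_ (Continuous.add ?_ ?_))
    · exact (WithLp.continuous_fst 2 _ _).comp (WithLp.continuous_fst 2 _ _)
    · exact (WithLp.continuous_snd 2 _ _).comp (WithLp.continuous_fst 2 _ _)
    · exact (WithLp.continuous_fst 2 _ _).comp (WithLp.continuous_snd 2 _ _)
  have h₂ : Continuous fun p : EProd (EProd (Rn n) (Rn m)) (EProd (Rn m) (Rn s)) =>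
      epair p.fst p.snd.snd :=
    (WithLp.prod_continuous_toLp 2 _ _).comp ((WithLp.continuous_fst 2 _ _).prodMk
      ((WithLp.continuous_snd 2 _ _).comp (WithLp.continuous_snd 2 _ _)))
  have : gph (mapCalH F G) =
      {p | epair p.fst.fst (p.fst.snd + p.snd.fst) ∈ gph F} ∩
        {p | epair p.fst p.snd.snd ∈ gph G} := by
    ext p
    constructor
    · rintro ⟨⟨a, ha, hap⟩, hg⟩
      refine ⟨?_, hg⟩
      have : p.fst.snd + p.snd.fst = a := by rw [← hap]; simp
      change p.fst.snd + p.snd.fst ∈ F p.fst.fst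
      rwa [this]
    · rintro ⟨h, hg⟩
      exact ⟨⟨_, h, add_sub_cancel_left _ _⟩, hg⟩
  rw [this]
  exact (hF.preimage h₁).inter (hG.preimage h₂)

/-- Normals to the graph of `H` lift to normals to the joint graph of `F` and `G`. -/
theorem exists_mem_limitingNormalCone_jointGraph (hF : IsClosed (gph F)) (hG : IsClosed (gph G))
    (hK : InnerSemicompactAt (mapKhat F G) (dom (mapKhat F G)) (epair z 0)) {ξ : Rn n} {ν : Rn s}
    (hξ : ξ ∈ coderivative (mapH F G) z 0 ν) :
    ∃ lam ∈ mapK F G z,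
      epair (epair ξ 0) (-ν) ∈ limitingNormalCone (jointGraph F G) (epair (epair z lam) 0) := by
  obtain ⟨zs, ξs, hz, hzz, hξs, hN⟩ := hξ
  have hdom : ∀ k, zs k ∈ dom (mapKhat F G) := fun k => by
    obtain ⟨lam, hl, hg⟩ := mem_iUnion₂.1 (hz k)
    exact ⟨lam, hl, hg⟩
  obtain ⟨φ, ls, lam, hφ, hls, hmem⟩ := hK zs hdom hzz
  have tφ := hφ.tendsto_atTop
  have hz' := hzz.comp tφ
  have hξ' := hξs.comp tφ
  have hlim : Tendsto (fun k => epair (epair (zs (φ k)).fst (ls k)) (zs (φ k)).snd) atTop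
      (𝓝 (epair (epair z lam) 0)) :=
    tendsto_epair (tendsto_epair (tendsto_fst hz') hls) (tendsto_snd hz')
  have hD : ∀ k, epair (epair (zs (φ k)).fst (ls k)) (zs (φ k)).snd ∈ jointGraph F G :=
    fun k => ⟨(hmem k).1, (hmem k).2⟩
  have hcl : IsClosed (jointGraph F G) := (isClosed_cylinder hF).inter hG
  obtain ⟨hl₁, hl₂⟩ := hcl.mem_of_tendsto hlim (Eventually.of_forall hD)
  refine ⟨lam, ⟨hl₁, hl₂⟩, _, fun k => epair (epair (ξs (φ k)).fst 0) (ξs (φ k)).snd, hD, hlim,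
    tendsto_epair (tendsto_epair (tendsto_fst hξ') tendsto_const_nhds) (tendsto_snd hξ'),
    fun k => ?_⟩
  -- The projection ((z, λ), w) ↦ (z, w) forgets λ, hence the zero λ-component.
  refine regularNormalCone_pullback (B := gph (mapH F G))
    (epairL ((WithLp.fstL 2 ℝ (Rn n) (Rn m)).comp (WithLp.fstL 2 ℝ (EProd (Rn n) (Rn m)) (Rn s)))
      (WithLp.sndL 2 ℝ (EProd (Rn n) (Rn m)) (Rn s))) ?_ ?_ (hN (φ k))
  · rintro p ⟨hp₁, hp₂⟩
    exact mem_iUnion₂.2 ⟨p.fst.snd, hp₁, hp₂⟩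
  · intro d
    rw [epairL_apply, inner_eprod, inner_eprod, inner_eprod]
    simp

/-- The inclusion map `((z, λ), w) ↦ ((z, λ), (0, w))`. -/
noncomputable def jointInclusion (n m s : ℕ) :
    EProd (EProd (Rn n) (Rn m)) (Rn s) →L[ℝ] EProd (EProd (Rn n) (Rn m)) (EProd (Rn m) (Rn s)) :=
  epairL (WithLp.fstL 2 ℝ _ _) (epairL 0 (WithLp.sndL 2 ℝ _ _))

/-- Under the kernel condition, normals to the joint graph are given by the coderivative of
`𝓗`. -/
theorem exists_mem_coderivative_mapCalH (hF : IsClosed (gph F)) (hG : IsClosed (gph G))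
    (hcq : KernelCQ F G z lam) {ξ : Rn n} {ν : Rn s}
    (hξ : epair (epair ξ 0) (-ν) ∈
      limitingNormalCone (jointGraph F G) (epair (epair z lam) 0)) :
    ∃ μ, epair ξ 0 ∈ coderivative (mapCalH F G) (epair z lam) (epair 0 0) (epair μ ν) := by
  set N : Set (EProd (EProd (Rn n) (Rn m)) (EProd (Rn m) (Rn s))) := {p | p.snd.fst = 0} with hN
  have hNcl : IsClosed N := isClosed_eq
    ((WithLp.continuous_fst 2 _ _).comp (WithLp.continuous_snd 2 _ _)) continuous_const
  have hnormal : ∀ {x q}, q ∈ limitingNormalCone N x → q.fst = 0 ∧ q.snd.snd = 0 := by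
    intro x q hq
    have h₁ := inner_eq_zero_of_mem_limitingNormalCone (d := epair q.fst 0)
      (fun y hy t => by simpa [hN] using hy) hq
    have h₂ := inner_eq_zero_of_mem_limitingNormalCone (d := epair 0 (epair 0 q.snd.snd))
      (fun y hy t => by simpa [hN] using hy) hq
    rw [inner_eprod] at h₁ h₂
    rw [inner_eprod q.snd] at h₂
    exact ⟨by simpa using h₁, by simpa using h₂⟩
  -- On gph 𝓗 ∩ N, dropping the zero slack lands in the joint graph. `jointInclusion` serves both as
  -- the adjoint of this projection and as its section.
  have hpull := limitingNormalCone_pullback (D := gph (mapCalH F G) ∩ N)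
    (epairL (WithLp.fstL 2 ℝ (EProd (Rn n) (Rn m)) (EProd (Rn m) (Rn s)))
      ((WithLp.sndL 2 ℝ (Rn m) (Rn s)).comp (WithLp.sndL 2 ℝ (EProd (Rn n) (Rn m)) _)))
    (by
      rintro p ⟨⟨⟨a, ha, hap⟩, hg⟩, hp0⟩
      refine ⟨?_, hg⟩
      have hp0 : p.snd.fst = 0 := hp0
      have : a = p.fst.snd := sub_eq_zero.1 (hap.trans hp0)
      change p.fst.snd ∈ F p.fst.fst
      rwa [← this])
    (jointInclusion n m s)
    (fun ζ d => by
      rw [jointInclusion, epairL_apply, epairL_apply, epairL_apply, inner_eprod, inner_eprod,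
        inner_eprod]
      simp)
    (jointInclusion n m s).continuous
    (by
      rintro p ⟨hp₁, hp₂⟩
      exact ⟨⟨⟨p.fst.snd, hp₁, sub_self _⟩, hp₂⟩, rfl⟩)
    (fun _ => rfl) hξ
  -- Normals to N live in the slack block only, so the qualification condition is exactly
  -- `KernelCQ`.
  obtain ⟨c, hc, l, hl, hcl⟩ := limitingNormalCone_inter_subset
    (isClosed_gph_mapCalH hF hG) hNcl (fun a ha hna => by
      obtain ⟨h₁, h₂⟩ := hnormal hna
      have h₁ : a.fst = 0 := by simpa using h₁
      have h₂ : a.snd.snd = 0 := by simpa using h₂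
      have ha' : a = epair (epair 0 0) (-epair (-a.snd.fst) 0) :=
        eprod_ext (h₁.trans rfl) (eprod_ext (by simp) (by simpa using h₂))
      rw [ha'] at ha
      have := neg_eq_zero.1 (hcq _ ha)
      exact eprod_ext h₁ (eprod_ext this h₂)) hpull
  obtain ⟨hl₁, hl₂⟩ := hnormal hl
  -- Only the slack block of c is undetermined by the sum; it becomes μ, with the sign of the
  -- coderivative convention.
  refine ⟨-c.snd.fst, ?_⟩
  have hc₁ : c.fst = epair ξ 0 := by
    have : (c + l).fst = epair ξ 0 := by rw [show c + l = _ from hcl]; rfl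
    simpa [hl₁] using this
  have hc₂ : c.snd.snd = -ν := by
    have : (c + l).snd.snd = -ν := by rw [show c + l = _ from hcl]; rfl
    simpa [hl₂] using this
  have : c = epair (epair ξ 0) (-epair (-c.snd.fst) ν) :=
    eprod_ext hc₁ (eprod_ext (by simp) (by simpa using hc₂))
  rw [mem_coderivative, ← this]
  exact hc

/-- Under the strong qualification condition, normals to the joint graph split into coderivatives
of `F` and `G`. -/
theorem exists_mem_coderivative_add (hF : IsClosed (gph F)) (hG : IsClosed (gph G))
    (hcq : StrongCQ F G z lam) {ξ : Rn n} {ν : Rn s}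
    (hξ : epair (epair ξ 0) (-ν) ∈
      limitingNormalCone (jointGraph F G) (epair (epair z lam) 0)) :
    ∃ μ, ∃ ξ₁ ∈ coderivative F z lam μ, ∃ ξ₂, epair ξ₂ μ ∈ coderivative G (epair z lam) 0 ν ∧
      ξ₁ + ξ₂ = ξ := by
  -- Cylinder normals have the form ((ξ, -μ), 0), which turns the qualification condition into
  -- `StrongCQ`.
  obtain ⟨c, hc, l, hl, hcl⟩ := limitingNormalCone_inter_subset
    (isClosed_cylinder hF) hG (fun a ha hna => by
      obtain ⟨h₁, h₂⟩ := mem_limitingNormalCone_cylinder ha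
      have := hcq a.fst.fst (-a.fst.snd)
        (by rw [mem_coderivative, neg_neg]; exact h₁)
        (by
          have e : epair (epair (-a.fst.fst) (-a.fst.snd)) (-0) = -a :=
            eprod_ext (eprod_ext (by simp) (by simp)) (by simp [h₂])
          rw [mem_coderivative, e]; exact hna)
      exact eprod_ext (eprod_ext this.1 (neg_eq_zero.1 this.2)) h₂) hξ
  obtain ⟨hc₁, hc₂⟩ := mem_limitingNormalCone_cylinder hc
  have hsum : c + l = epair (epair ξ 0) (-ν) := hcl
  have e₁ : c.fst.fst + l.fst.fst = ξ := congrArg (fun p => p.fst.fst) hsum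
  have e₂ : c.fst.snd + l.fst.snd = 0 := congrArg (fun p => p.fst.snd) hsum
  have e₃ : c.snd + l.snd = -ν := congrArg (fun p => p.snd) hsum
  rw [hc₂, zero_add] at e₃
  refine ⟨l.fst.snd, c.fst.fst, ?_, l.fst.fst, ?_, e₁⟩
  · rw [← eq_neg_iff_add_eq_zero] at e₂
    rw [mem_coderivative, ← e₂]
    exact hc₁
  · rw [mem_coderivative, ← e₃]
    exact hl

/-- With ν = 0, `Inc` splits the zero vector as (ξ, -μ) + (-ξ, μ), which is the premise of `MuCQ`.
-/
theorem MuCQ.kernelCQ (hInc : Inc F G z lam) (hcq : MuCQ F G z lam) : KernelCQ F G z lam := by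
  intro μ hμ
  obtain ⟨a, ⟨ha₁, ha₂⟩, b, hb, hab⟩ := hInc μ 0 hμ
  have hsum : a + b = epair 0 0 := hab
  have e₁ : a.fst + b.fst = 0 := congrArg (fun p => p.fst) hsum
  have e₂ : a.snd + b.snd = 0 := congrArg (fun p => p.snd) hsum
  have ha₂ : a.snd = -μ := ha₂
  refine hcq a.fst μ ha₁ ?_
  have : epair (-a.fst) μ = b := eprod_ext (by simpa using neg_eq_of_add_eq_zero_right e₁)
    (by simpa [ha₂, neg_add_eq_zero] using e₂)
  rwa [this]

theorem fuzzilyMStationary_of_kernelCQ (hF : IsClosed (gph F)) (hG : IsClosed (gph G))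
    (hz : ImplicitlyMStationary f F G M z)
    (hK : InnerSemicompactAt (mapKhat F G) (dom (mapKhat F G)) (epair z 0))
    (hcq : ∀ lam ∈ mapK F G z, KernelCQ F G z lam) : FuzzilyMStationary f F G M z := by
  obtain ⟨hfeas, ν, _, ⟨a, ha, ξ, hξ, rfl⟩, b, hb, hsum⟩ := hz
  obtain ⟨lam, hlam, hN⟩ := exists_mem_limitingNormalCone_jointGraph hF hG hK hξ
  obtain ⟨μ, hμ⟩ := exists_mem_coderivative_mapCalH hF hG (hcq lam hlam) hN
  refine ⟨hfeas, lam, hlam, μ, ν, _, ⟨epair a 0, ⟨ha, rfl⟩, _, hμ, rfl⟩, epair b 0, ⟨hb, rfl⟩, ?_⟩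
  exact eprod_ext hsum (by simp)

/-- The λ-component of the fuzzy condition forces the G-part supplied by `Inc` to have second
component μ. -/
theorem FuzzilyMStationary.explicitlyMStationary (hz : FuzzilyMStationary f F G M z)
    (hInc : ∀ lam ∈ mapK F G z, Inc F G z lam) : ExplicitlyMStationary f F G M z := by
  obtain ⟨hfeas, lam, hlam, μ, ν, _, ⟨a, ⟨ha, ha0⟩, ξ, hξ, rfl⟩, b, ⟨hb, hb0⟩, hsum⟩ := hz
  obtain ⟨c, ⟨hc₁, hc₂⟩, d, hd, rfl⟩ := hInc lam hlam μ ν hξ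
  have hsum : a + (c + d) + b = epair 0 0 := hsum
  have e₁ : a.fst + (c.fst + d.fst) + b.fst = 0 := congrArg (fun p => p.fst) hsum
  have e₂ : a.snd + (c.snd + d.snd) + b.snd = 0 := congrArg (fun p => p.snd) hsum
  have ha0 : a.snd = 0 := ha0
  have hb0 : b.snd = 0 := hb0
  have hc₂ : c.snd = -μ := hc₂
  rw [ha0, hb0, hc₂, zero_add, add_zero, neg_add_eq_zero] at e₂
  refine ⟨hfeas, lam, hlam, μ, ν, _,
    ⟨_, ⟨a.fst, ha, c.fst, hc₁, rfl⟩, d.fst,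
      show epair d.fst μ ∈ coderivative G (epair z lam) 0 ν from ?_, rfl⟩, b.fst, hb, ?_⟩
  · rw [e₂]
    exact hd
  · exact (congrArg (· + b.fst) (add_assoc a.fst c.fst d.fst)).trans e₁

theorem explicitlyMStationary_of_strongCQ (hF : IsClosed (gph F)) (hG : IsClosed (gph G))
    (hz : ImplicitlyMStationary f F G M z)
    (hK : InnerSemicompactAt (mapKhat F G) (dom (mapKhat F G)) (epair z 0))
    (hcq : ∀ lam ∈ mapK F G z, StrongCQ F G z lam) : ExplicitlyMStationary f F G M z := by
  obtain ⟨hfeas, ν, _, ⟨a, ha, ξ, hξ, rfl⟩, b, hb, hsum⟩ := hz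
  obtain ⟨lam, hlam, hN⟩ := exists_mem_limitingNormalCone_jointGraph hF hG hK hξ
  obtain ⟨μ, ξ₁, h₁, ξ₂, h₂, rfl⟩ := exists_mem_coderivative_add hF hG (hcq lam hlam) hN
  exact ⟨hfeas, lam, hlam, μ, ν, _, ⟨_, ⟨a, ha, ξ₁, h₁, rfl⟩, ξ₂, h₂, rfl⟩, b, hb,
    (congrArg (· + b) (add_assoc a ξ₁ ξ₂)).trans hsum⟩

theorem AubinAt.strongCQ (hG : AubinAt G (epair z lam) 0) : StrongCQ F G z lam := by
  intro ξ μ _ h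
  have h0 := hG.eq_zero_of_mem_coderivative_zero h
  exact ⟨neg_eq_zero.1 (congrArg (fun p => p.fst) h0), congrArg (fun p => p.snd) h0⟩

theorem MetricallyRegularAt.kernelCQ
    (h : MetricallyRegularAt (mapCalH F G) (epair z lam) (epair 0 0)) : KernelCQ F G z lam :=
  fun _ hμ => congrArg (fun p => p.fst) (h.eq_zero_of_zero_mem_coderivative hμ)

end Stationarity

end ImplicitVariables

theorem corollary4p15 {n m s : ℕ}
    (f : Rn n → ℝ) (hf : LocallyLipschitz f)
    (F : Rn n → Set (Rn m)) (hF : IsClosed (gph F))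
    (G : EProd (Rn n) (Rn m) → Set (Rn s)) (hG : IsClosed (gph G))
    (M : Set (Rn n)) (hM : IsClosed M)
    (z : Rn n) (hz : ImplicitlyMStationary f F G M z)
    (hK : InnerSemicompactAt (mapKhat F G) (dom (mapKhat F G)) (epair z 0)) :
    -- (a)
    (((∀ lam ∈ mapK F G z, KernelCQ F G z lam) →
        FuzzilyMStationary f F G M z ∧
        ((∀ lam ∈ mapK F G z, Inc F G z lam) → ExplicitlyMStationary f F G M z)) ∧
      (∀ lam ∈ mapK F G z,
        MetricallyRegularAt (mapCalH F G) (epair z lam) (epair 0 0) → KernelCQ F G z lam)) ∧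
    -- (b)
    (((∀ lam ∈ mapK F G z, Inc F G z lam) → (∀ lam ∈ mapK F G z, MuCQ F G z lam) →
        ExplicitlyMStationary f F G M z) ∧
      (∀ lam ∈ mapK F G z, AubinAt G (epair z lam) 0 → MuCQ F G z lam)) ∧
    -- (c)
    (((∀ lam ∈ mapK F G z, StrongCQ F G z lam) → ExplicitlyMStationary f F G M z) ∧
      (∀ lam ∈ mapK F G z, AubinAt G (epair z lam) 0 → StrongCQ F G z lam)) := by
  refine ⟨⟨fun h => ?_, fun _ _ => MetricallyRegularAt.kernelCQ⟩, ⟨fun hInc h => ?_, ?_⟩,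
    explicitlyMStationary_of_strongCQ hF hG hz hK, fun _ _ => AubinAt.strongCQ⟩
  · have hfuz := fuzzilyMStationary_of_kernelCQ hF hG hz hK h
    exact ⟨hfuz, hfuz.explicitlyMStationary⟩
  · exact (fuzzilyMStationary_of_kernelCQ hF hG hz hK fun lam hlam =>
      (h lam hlam).kernelCQ (hInc lam hlam)).explicitlyMStationary hInc
  · exact fun _ _ hA ξ μ h₁ h₂ => (hA.strongCQ ξ μ h₁ h₂).2
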